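/- Theorem 16.2. A commutative ring $R$ with identity is said to have property (P) if, whenever $I \subsetneq J$ are ideals of $R$, one has $I^n \subsetneq J^n$ for all integers $n \ge 1$. Let $R$ be a Noetherian integral domain. If $R$ has property (P), then the Krull dimension of $R$ is at most $1$. -/

import Mathlib

/-- Property (P): whenever `I ⊊ J` are ideals of `R`, one has `I ^ n ⊊ J ^ n` for all `n ≥ 1`. -/
def PropertyP (R : Type*) [CommRing R] : Prop :=
  ∀ I J : Ideal R, I < J → ∀ n : ℕ, 1 ≤ n → I ^ n < J ^ n

/-! If a prime `m` had height at least 2, choose `a ≠ 0` and `b` in `m` with `b` outside every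
minimal prime of `(a)`. By (P), `b/a` is a root of a quartic `g` with `X ^ 2`-coefficient 1, so `g ∉
m R[X]`. A prime `P ⊆ m R[X]` minimal over `b - aX` contains `a ^ 4 g`, hence `a` and then `b`. This
forces height at least 2, against Krull's principal ideal theorem. -/

/-- Adjoining to an ideal `I` an element `z` with `z I ⊆ I ^ 2` and `z ^ 2 ∈ I ^ 2` does not change
the square of `I`. Under property (P) such an element therefore lies in `I`. -/
lemma PropertyP.mem_of_mul_mem_sq {R : Type*} [CommRing R] (hP : PropertyP R) {I : Ideal R} {z : R}
    (hI : ∀ x ∈ I, x * z ∈ I ^ 2) (hz : z * z ∈ I ^ 2) : z ∈ I := by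
  by_contra hzI
  have hlt : I < I ⊔ Ideal.span {z} :=
    left_lt_sup.2 fun h => hzI (h (Ideal.mem_span_singleton_self z))
  refine (hP I _ hlt 2 one_le_two).not_ge ?_
  have hIz : I * Ideal.span {z} ≤ I ^ 2 :=
    Ideal.mul_le.2 fun x hx y hy => by
      obtain ⟨c, rfl⟩ := Ideal.mem_span_singleton'.1 hy
      rw [mul_left_comm]
      exact Ideal.mul_mem_left _ c (hI x hx)
  rw [sq (I ⊔ Ideal.span {z}), Ideal.sup_mul, Ideal.mul_sup, Ideal.mul_sup,
    mul_comm (Ideal.span {z}) I, Ideal.span_singleton_mul_span_singleton]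
  exact sup_le (sup_le (sq I).ge hIz)
    (sup_le hIz ((Ideal.span_singleton_le_iff_mem _).2 hz))

/-- Under property (P), any two elements satisfy a binary quartic relation in which the coefficient
of the middle monomial is `1`. -/
lemma PropertyP.exists_quartic_relation {R : Type*} [CommRing R] (hP : PropertyP R) (a b : R) :
    ∃ c₀ c₁ c₃ c₄ : R,
      a ^ 2 * b ^ 2 = c₀ * a ^ 4 + c₁ * (a ^ 3 * b) + c₃ * (a * b ^ 3) + c₄ * b ^ 4 := by
  -- All quartic monomials except `a ^ 2 * b ^ 2`: the other four already produce every degree-8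
  -- monomial as a pairwise product.
  set I : Ideal R := Ideal.span {a ^ 4, a ^ 3 * b, a * b ^ 3, b ^ 4} with hI
  have h0 : a ^ 4 ∈ I := Ideal.subset_span (by simp)
  have h1 : a ^ 3 * b ∈ I := Ideal.subset_span (by simp)
  have h3 : a * b ^ 3 ∈ I := Ideal.subset_span (by simp)
  have h4 : b ^ 4 ∈ I := Ideal.subset_span (by simp)
  have hmul : ∀ {x y w : R}, x ∈ I → y ∈ I → x * y = w → w ∈ I ^ 2 := fun hx hy h => by
    rw [← h, sq]
    exact Ideal.mul_mem_mul hx hy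
  have hmem : a ^ 2 * b ^ 2 ∈ I := by
    refine hP.mem_of_mul_mem_sq (fun x hx => ?_) (hmul h0 h4 (by ring))
    refine Submodule.span_induction (p := fun x _ => x * (a ^ 2 * b ^ 2) ∈ I ^ 2)
      ?_ (by simp) (fun x y _ _ hx hy => ?_) (fun r x _ hx => ?_) hx
    · rintro x (rfl | rfl | rfl | rfl)
      · exact hmul h1 h1 (by ring)
      · exact hmul h0 h3 (by ring)
      · exact hmul h1 h4 (by ring)
      · exact hmul h3 h3 (by ring)
    · rw [add_mul]
      exact add_mem hx hy
    · rw [smul_mul_assoc]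
      exact Submodule.smul_mem _ r hx
  simp only [hI, Ideal.mem_span_insert, Ideal.mem_span_singleton'] at hmem
  obtain ⟨c₀, _, ⟨c₁, _, ⟨c₃, _, ⟨c₄, rfl⟩, rfl⟩, rfl⟩, h⟩ := hmem
  exact ⟨c₀, c₁, c₃, c₄, by rw [h]; ring⟩

/-- In a domain, a nonzero prime properly contained in another prime forces height at least two. -/
lemma Ideal.one_lt_height_of_bot_lt_of_lt {S : Type*} [CommRing S] [IsDomain S] {p q : Ideal S}
    [hp : p.IsPrime] [q.IsPrime] (h0 : ⊥ < p) (hpq : p < q) : 1 < q.height := by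
  by_contra! h
  have h1 : p.height < (1 : ℕ) := Ideal.height_le_iff.1 (by exact_mod_cast h) p hp hpq
  have h2 : p.height ≤ (0 : ℕ) := by
    exact_mod_cast (Order.lt_one_iff.1 (by exact_mod_cast h1)).le
  exact not_lt_zero (Ideal.height_le_iff.1 h2 ⊥ Ideal.isPrime_bot h0)

/-- In a Noetherian ring, an ideal of height at least two contains an element avoiding all minimal
primes of a given principal ideal. -/
lemma Ideal.exists_notMem_minimalPrimes_of_one_lt_height {R : Type*} [CommRing R]
    [IsNoetherianRing R] {m : Ideal R} (hm : 1 < m.height) (a : R) :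
    ∃ b ∈ m, ∀ p ∈ (Ideal.span {a}).minimalPrimes, b ∉ p := by
  have hfin := (Ideal.span {a}).finite_minimalPrimes_of_isNoetherianRing
  have : ¬(m : Set R) ⊆ ⋃ p ∈ hfin.toFinset, (p : Set R) := by
    -- Prime avoidance exempts two ideals from primality; all are prime here, so `⊥ ⊥` are dummies.
    refine (Ideal.subset_union_prime ⊥ ⊥
      fun p hp _ _ => (hfin.mem_toFinset.1 hp).isPrime).not.mpr ?_
    rintro ⟨p, hp, hmp⟩
    exact (hm.trans_le (Ideal.height_mono hmp)).not_ge
      (Ideal.height_le_one_of_isPrincipal_of_mem_minimalPrimes _ p (hfin.mem_toFinset.1 hp))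
  obtain ⟨b, hb, hb'⟩ := Set.not_subset.1 this
  refine ⟨b, hb, fun p hp hbp => hb' ?_⟩
  exact Set.mem_biUnion (hfin.mem_toFinset.2 hp) hbp

open Polynomial in
/-- If `b` avoids the minimal primes of a nonzero `a`, then a prime of `R[X]` containing both has
height at least two. -/
lemma Polynomial.one_lt_height_of_mem {R : Type*} [CommRing R] [IsDomain R] {a b : R}
    (ha : a ≠ 0) (hb : ∀ p ∈ (Ideal.span {a}).minimalPrimes, b ∉ p) {P : Ideal R[X]} [P.IsPrime]
    (haP : C a ∈ P) (hbP : C b ∈ P) : 1 < P.height := by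
  set q : Ideal R := P.comap C
  obtain ⟨p, hp, hpq⟩ := Ideal.exists_minimalPrimes_le (I := Ideal.span {a}) (J := q)
    ((Ideal.span_singleton_le_iff_mem _).2 haP)
  have hpp := hp.isPrime
  have hpP : p.map C ≤ P := (Ideal.map_mono hpq).trans Ideal.map_comap_le
  have hap : a ∈ p := hp.1.2 (Ideal.mem_span_singleton_self a)
  have : (p.map (C : R →+* R[X])).IsPrime := (Ideal.isPrime_map_C_iff_isPrime p).2 hpp
  refine Ideal.one_lt_height_of_bot_lt_of_lt (p := p.map C) (bot_lt_iff_ne_bot.2 fun h => ha ?_)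
    (lt_of_le_of_ne hpP fun h => hb p hp ?_)
  · have : C a ∈ (⊥ : Ideal R[X]) := h ▸ Ideal.mem_map_of_mem C hap
    simpa using this
  · rw [← h, Ideal.mem_map_C_iff] at hbP
    simpa using hbP 0

open Polynomial in
theorem theorem16p2 {R : Type*} [CommRing R] [IsDomain R] [IsNoetherianRing R]
    (hP : PropertyP R) : ringKrullDim R ≤ 1 := by
  rw [ringKrullDim_le_iff_height_le]
  intro m hm
  by_contra! hht
  replace hht : 1 < m.height := by exact_mod_cast hht
  obtain ⟨a, ham, ha⟩ : ∃ a ∈ m, a ≠ 0 := Submodule.exists_mem_ne_zero_of_ne_bot <| by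
    rintro rfl
    simp at hht
  obtain ⟨b, hbm, hb⟩ := Ideal.exists_notMem_minimalPrimes_of_one_lt_height hht a
  obtain ⟨c₀, c₁, c₃, c₄, hrel⟩ := hP.exists_quartic_relation a b
  set t : R[X] := C b - C a * X with ht
  have hm' : (m.map (C : R →+* R[X])).IsPrime := (Ideal.isPrime_map_C_iff_isPrime m).2 hm
  have htm : t ∈ m.map C := sub_mem (Ideal.mem_map_of_mem C hbm)
    (Ideal.mul_mem_right _ _ (Ideal.mem_map_of_mem C ham))
  obtain ⟨P, hPt, hPm⟩ := Ideal.exists_minimalPrimes_le (I := Ideal.span {t}) (J := m.map C)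
    ((Ideal.span_singleton_le_iff_mem _).2 htm)
  have hPp := hPt.isPrime
  have htP : t ∈ P := hPt.1.2 (Ideal.mem_span_singleton_self t)
  set g : R[X] := X ^ 2 - C c₀ - C c₁ * X - C c₃ * X ^ 3 - C c₄ * X ^ 4 with hg
  have hgP : g ∉ P := fun h => hm.ne_top <| (Ideal.eq_top_iff_one m).2 <| by
    simpa [hg, coeff_X, coeff_C] using Ideal.mem_map_C_iff.1 (hPm h) 2
  have hgt : C a ^ 4 * g ∈ P := by
    have hrel' := congrArg (C : R →+* R[X]) hrel
    simp only [map_mul, map_add, map_pow] at hrel'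
    -- Subtracting the relation from `a ^ 4 g` leaves multiples of `(aX) ^ k - b ^ k`, each
    -- divisible by `t`.
    have : C a ^ 4 * g = t * -(C a ^ 2 * (C b + C a * X) - C c₁ * C a ^ 3
        - C c₃ * C a * (C b ^ 2 + C b * (C a * X) + (C a * X) ^ 2)
        - C c₄ * (C b ^ 3 + C b ^ 2 * (C a * X) + C b * (C a * X) ^ 2 + (C a * X) ^ 3)) := by
      rw [hg, ht]
      linear_combination hrel'
    rw [this]
    exact Ideal.mul_mem_right _ _ htP
  have haP : C a ∈ P := hPp.mem_of_pow_mem 4 ((hPp.mem_or_mem hgt).resolve_right hgP)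
  have hbP : C b ∈ P := by
    have := add_mem htP (Ideal.mul_mem_right X _ haP)
    rwa [ht, sub_add_cancel] at this
  exact (Polynomial.one_lt_height_of_mem ha hb haP hbP).not_ge
    (Ideal.height_le_one_of_isPrincipal_of_mem_minimalPrimes _ P hPt)
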